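/- A knot projection $P$ is the image of a smooth generic immersion of a circle into $S^2$ (all multiple points are transverse double points) with at least one double point. It is reducible if it has a nugatory crossing, that is, a double point whose removal disconnects $P$. A non-Seifert splice replaces, in a small disc about a double point, the crossing by two disjoint arcs, one joining the two points at which $P$ (with either orientation) enters the disc and the other joining the two points at which it leaves it. The reductivity $r(P)$ is the minimum number of non-Seifert splices, applied one after the other, needed to obtain a reducible knot projection from $P$. The chord diagram of $P$ is the circle with, for every double point of $P$, a chord joining its two preimages. Theorem. If a knot projection $P$ has $r(P)=2$, then its chord diagram contains the "H" configuration as a sub-chord diagram: there are three double points whose chords $h,a,b$ are such that $h$ crosses both $a$ and $b$, while $a$ and $b$ do not cross each other; that is, the six end points occur on the circle in the cyclic order $h\,a\,b\,h\,b\,a$. -/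

import Mathlib

open scoped ContDiff

/-- The sphere `S²`, as the unit sphere of Euclidean 3-space. -/
abbrev S2 : Type := Metric.sphere (0 : EuclideanSpace ℝ (Fin 3)) 1

/-- A closed curve `ℝ/ℤ → S²`, read as a `1`-periodic map from `ℝ` to Euclidean 3-space. -/
def periodicLift (f : UnitAddCircle → S2) (t : ℝ) : EuclideanSpace ℝ (Fin 3) :=
  (f (t : UnitAddCircle) : EuclideanSpace ℝ (Fin 3))

/-- A knot projection (spherical curve), given by a parametrization: a smooth generic immersion of
the circle `ℝ/ℤ` into `S²`, with at least one double point. Generic means that all multiple points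
are transverse double points. The curve itself is `Set.range P`; the notions below do not depend
on the direction in which the parametrization runs. -/
structure KnotProjection where
  toFun : UnitAddCircle → S2
  smooth : ContDiff ℝ ∞ (periodicLift toFun)
  immersion : ∀ t : ℝ, deriv (periodicLift toFun) t ≠ 0
  transverse : ∀ s t : ℝ, (s : UnitAddCircle) ≠ (t : UnitAddCircle) →
    toFun s = toFun t →
      LinearIndependent ℝ ![deriv (periodicLift toFun) s, deriv (periodicLift toFun) t]
  no_triple : ∀ x y z : UnitAddCircle,
    toFun x = toFun y → toFun y = toFun z → x = y ∨ y = z ∨ x = z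
  exists_double : ∃ x y : UnitAddCircle, x ≠ y ∧ toFun x = toFun y

namespace KnotProjection

instance : CoeFun KnotProjection (fun _ => UnitAddCircle → S2) := ⟨KnotProjection.toFun⟩

/-- `p` is a double point of the knot projection. -/
def IsDoublePoint (P : KnotProjection) (p : S2) : Prop :=
  ∃ x y : UnitAddCircle, x ≠ y ∧ P x = p ∧ P y = p

/-- A nugatory crossing: a double point at which two otherwise disjoint parts of the curve are
joined, that is, whose removal disconnects the curve. -/
def IsNugatory (P : KnotProjection) (p : S2) : Prop :=
  P.IsDoublePoint p ∧ ¬ IsPreconnected (Set.range P \ {p})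

/-- A knot projection is reducible if it has a nugatory crossing. -/
def IsReducible (P : KnotProjection) : Prop :=
  ∃ p : S2, P.IsNugatory p

/-- `Q` is obtained from `P` by a non-Seifert splice at the double point `P s = P t`.

There is a round closed disc `D ⊂ S²` about the double point which meets `P` exactly in the two
branches `P [a, b]` and `P [c, d]` through it, and `D` contains no other double point. Running
along `P`, one enters `D` at `P a` and `P c`, and leaves it at `P b` and `P d`. Outside `D` the
curve is kept. Inside `D` the crossing is replaced by two disjoint simple arcs, one joining the two
points of entry and the other joining the two points of exit; so the splice is the one which does
not respect the orientations of the branches. -/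
def IsNonSeifertSplice (P Q : KnotProjection) : Prop :=
  ∃ (a s b c t d ρ : ℝ),
    a < s ∧ s < b ∧ b < c ∧ c < t ∧ t < d ∧ d < a + 1 ∧ 0 < ρ ∧
    P s = P t ∧
    (∀ x ∈ Set.Ico a (a + 1),
      (P x ∈ Metric.closedBall (P s) ρ ↔ x ∈ Set.Icc a b ∪ Set.Icc c d) ∧
      (P x ∈ Metric.ball (P s) ρ ↔ x ∈ Set.Ioo a b ∪ Set.Ioo c d)) ∧
    (∀ x ∈ Set.Icc a b ∪ Set.Icc c d, ∀ y ∈ Set.Icc a b ∪ Set.Icc c d,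
      P x = P y → x = y ∨ (x = s ∧ y = t) ∨ (x = t ∧ y = s)) ∧
    ∃ (α : Path (P a) (P c)) (β : Path (P b) (P d)),
      Function.Injective α ∧ Function.Injective β ∧
      Disjoint (Set.range α) (Set.range β) ∧
      (∀ τ ∈ Set.Ioo (0 : unitInterval) 1,
        α τ ∈ Metric.ball (P s) ρ ∧ β τ ∈ Metric.ball (P s) ρ) ∧
      Set.range Q =
        (Set.range P \ Metric.closedBall (P s) ρ) ∪ (Set.range α ∪ Set.range β)

/-- `P.ReducesIn n`: some `n` successive non-Seifert splices turn `P` into a reducible knot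
projection. -/
inductive ReducesIn : KnotProjection → ℕ → Prop
  | zero {P : KnotProjection} : P.IsReducible → ReducesIn P 0
  | succ {P Q : KnotProjection} {n : ℕ} :
      IsNonSeifertSplice P Q → ReducesIn Q n → ReducesIn P (n + 1)

/-- Shimizu's reductivity `r(P)`: the least number of non-Seifert splices, applied one after the
other, which turn `P` into a reducible knot projection (`⊤` if there is no such number). -/
noncomputable def reductivity (P : KnotProjection) : ℕ∞ :=
  sInf ((fun n : ℕ => (n : ℕ∞)) '' {n : ℕ | P.ReducesIn n})

/-- The chord diagram of `P`: on the circle `ℝ/ℤ`, the chords joining the two preimages of each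
double point. -/
def chordDiagram (P : KnotProjection) : Set (Sym2 UnitAddCircle) :=
  {e | ∃ x y : UnitAddCircle, x ≠ y ∧ P x = P y ∧ e = s(x, y)}

end KnotProjection

/-- The chord diagram `C` contains the chord diagram with cyclic (Gauss) word `w` as a sub-chord
diagram: there are `m` points which are met in the given order in one turn around the circle, and
points with the same letter are the two ends of a chord of `C`. -/
def HasSubChordDiagram (C : Set (Sym2 UnitAddCircle)) {m n : ℕ} (w : Fin m → Fin n) : Prop :=
  ∃ x : Fin m → ℝ, StrictMono x ∧ (∀ i j, x j < x i + 1) ∧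
    ∀ i j, i ≠ j → w i = w j → s((x i : UnitAddCircle), (x j : UnitAddCircle)) ∈ C

/-- The three-chord diagram of the shape `H`: two chords `1`, `2` which do not cross each other,
and a chord `0` which crosses both of them. -/
def hWord : Fin 6 → Fin 3 := ![0, 1, 2, 0, 2, 1]

namespace KnotProjection

/-! Suppose `P` is irreducible and has no `H`. Let `P s = P t` be the crossing spliced first. It is
not nugatory, so some chord `uw` crosses `st`. The splice reverses one of the two arcs cut out by
`st`, so `P u` now cuts the new curve into two pieces, one through `β` and one through `α`. A common
point of these pieces other than `P u` would be a double point of `P` whose chord `xy` crosses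
exactly one of `st` and `uw`; since those two cross each other, the three chords form `H`. Hence `P
u` is nugatory after a single splice (`IsNonSeifertSplice.isReducible`), so the reductivity is at
most 1. Only the image of the spliced curve enters, never its parametrization. -/

lemma continuous_real (P : KnotProjection) : Continuous fun t : ℝ => P (t : UnitAddCircle) :=
  Continuous.subtype_mk P.smooth.continuous _

lemma apply_add_one (P : KnotProjection) (t : ℝ) :
    P ((t + 1 : ℝ) : UnitAddCircle) = P (t : UnitAddCircle) := by
  rw [AddCircle.coe_add_period]

lemma exists_mem_Ico_coe_eq (a : ℝ) (z : UnitAddCircle) :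
    ∃ x ∈ Set.Ico a (a + 1), (x : UnitAddCircle) = z := by
  obtain ⟨x, hx, rfl⟩ : z ∈ ((↑) : ℝ → UnitAddCircle) '' Set.Ico a (a + 1) := by
    rw [AddCircle.coe_image_Ico_eq]; trivial
  exact ⟨x, hx, rfl⟩

lemma coe_ne_coe_of_lt {x y : ℝ} (h : x < y) (h' : y < x + 1) :
    (x : UnitAddCircle) ≠ (y : UnitAddCircle) := by
  intro e
  have := (AddCircle.coe_eq_coe_iff_of_mem_Ico (p := (1 : ℝ)) (a := x)
    ⟨le_rfl, by linarith⟩ ⟨h.le, h'⟩).1 e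
  linarith

/-- A point of a knot projection whose removal disconnects it is a double point. -/
lemma isNugatory_of_not_isPreconnected (Q : KnotProjection) {p : S2} (hp : p ∈ Set.range Q)
    (h : ¬ IsPreconnected (Set.range Q \ {p})) : Q.IsNugatory p := by
  refine ⟨?_, h⟩
  by_contra hd
  apply h
  obtain ⟨z, rfl⟩ := hp
  obtain ⟨r, rfl⟩ := QuotientAddGroup.mk_surjective z
  -- Removing a simple point leaves the image of an open interval, which is connected.
  have : Set.range Q \ {Q (r : UnitAddCircle)} =
      (fun t : ℝ => Q (t : UnitAddCircle)) '' Set.Ioo r (r + 1) := by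
    ext q
    constructor
    · rintro ⟨⟨w, rfl⟩, hw⟩
      obtain ⟨x, hx, rfl⟩ := exists_mem_Ico_coe_eq r w
      refine ⟨x, ⟨lt_of_le_of_ne hx.1 ?_, hx.2⟩, rfl⟩
      rintro rfl
      exact hw rfl
    · rintro ⟨x, hx, rfl⟩
      refine ⟨⟨_, rfl⟩, fun e => hd ?_⟩
      exact ⟨_, _, coe_ne_coe_of_lt hx.1 hx.2, rfl, e⟩
  rw [this]
  exact isPreconnected_Ioo.image _ Q.continuous_real.continuousOn

/-- A double point which is not nugatory is the double point of a chord that is crossed by another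
chord. -/
lemma exists_crossing_chord (P : KnotProjection) (hP : ¬ P.IsReducible) {s t : ℝ} (hst : s < t)
    (hts : t < s + 1) (h : P s = P t) :
    ∃ u ∈ Set.Ioo s t, ∃ v ∈ Set.Ioo t (s + 1), P u = P v := by
  have hpre : IsPreconnected (Set.range P \ {P s}) := by
    by_contra hc
    exact hP ⟨P s, P.isNugatory_of_not_isPreconnected ⟨_, rfl⟩ hc⟩
  have hcl : ∀ x y : ℝ, IsClosed ((fun r : ℝ => P (r : UnitAddCircle)) '' Set.Icc x y) :=
    fun x y => (isCompact_Icc.image P.continuous_real).isClosed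
  have hnt : ∀ x : ℝ, ∀ y > x, y < x + 1 → P x = P y →
      ∀ z ∈ Set.Ioo x y, P z ≠ P x := by
    intro x y hxy hyx e z hz e'
    rcases P.no_triple x z y e'.symm (e'.trans e) with h1 | h1 | h1
    · exact coe_ne_coe_of_lt hz.1 (by linarith [hz.2]) h1
    · exact coe_ne_coe_of_lt hz.2 (by linarith [hz.1]) h1
    · exact coe_ne_coe_of_lt hxy hyx h1
  -- The two loops at `P s` are closed and cover the curve; as the curve minus `P s` is connected,
  -- they meet again elsewhere.
  obtain ⟨q, ⟨-, hq⟩, ⟨u, hu, rfl⟩, ⟨v, hv, hvu⟩⟩ := isPreconnected_closed_iff.1 hpre _ _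
    (hcl s t) (hcl t (s + 1)) (by
      rintro q ⟨⟨w, rfl⟩, -⟩
      obtain ⟨x, hx, rfl⟩ := exists_mem_Ico_coe_eq s w
      rcases le_total x t with h | h
      · exact Or.inl ⟨x, ⟨hx.1, h⟩, rfl⟩
      · exact Or.inr ⟨x, ⟨h, hx.2.le⟩, rfl⟩)
    (by
      have hm : (s + t) / 2 ∈ Set.Ioo s t := ⟨by linarith, by linarith⟩
      exact ⟨P ((s + t) / 2 : ℝ), ⟨⟨_, rfl⟩, hnt s t hst hts h _ hm⟩, _, ⟨hm.1.le, hm.2.le⟩, rfl⟩)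
    (by
      have hm : (t + (s + 1)) / 2 ∈ Set.Ioo t (s + 1) := ⟨by linarith, by linarith⟩
      refine ⟨P ((t + (s + 1)) / 2 : ℝ), ⟨⟨_, rfl⟩, ?_⟩, _, ⟨hm.1.le, hm.2.le⟩, rfl⟩
      rw [Set.mem_singleton_iff, h]
      exact hnt t (s + 1) hts (by linarith) (by rw [apply_add_one, h]) _ hm)
  have hus : u ≠ s := by rintro rfl; exact hq rfl
  have hut : u ≠ t := by rintro rfl; exact hq h.symm
  have hvt : v ≠ t := by rintro rfl; exact hq (hvu.symm.trans h.symm)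
  have hvs : v ≠ s + 1 := by
    rintro rfl
    exact hq (hvu.symm.trans (P.apply_add_one s))
  exact ⟨u, ⟨lt_of_le_of_ne hu.1 hus.symm, lt_of_le_of_ne hu.2 hut⟩, v,
    ⟨lt_of_le_of_ne hv.1 hvt.symm, lt_of_le_of_ne hv.2 hvs⟩, hvu.symm⟩

/-- Spanning less than one period keeps the six points distinct on the circle, as `chordDiagram`
requires. -/
lemma hasSubChordDiagram_hWord (P : KnotProjection) {x₀ x₁ x₂ x₃ x₄ x₅ : ℝ} (h₀ : x₀ < x₁)
    (h₁ : x₁ < x₂) (h₂ : x₂ < x₃) (h₃ : x₃ < x₄) (h₄ : x₄ < x₅) (h₅ : x₅ < x₀ + 1)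
    (e₀ : P x₀ = P x₃) (e₁ : P x₁ = P x₅) (e₂ : P x₂ = P x₄) :
    HasSubChordDiagram P.chordDiagram hWord := by
  have hmono : StrictMono ![x₀, x₁, x₂, x₃, x₄, x₅] := by
    rw [Fin.strictMono_iff_lt_succ]
    intro i
    fin_cases i <;> simpa
  have hspan : ∀ i j, ![x₀, x₁, x₂, x₃, x₄, x₅] j < ![x₀, x₁, x₂, x₃, x₄, x₅] i + 1 := by
    intro i j
    have hi := hmono.monotone (Fin.zero_le i)
    have hj := hmono.monotone (Fin.le_last j)
    have hl : ![x₀, x₁, x₂, x₃, x₄, x₅] (Fin.last 5) = x₅ := rfl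
    have hz : ![x₀, x₁, x₂, x₃, x₄, x₅] 0 = x₀ := rfl
    linarith
  refine ⟨_, hmono, hspan, fun i j hij hw => ⟨_, _, ?_, ?_, rfl⟩⟩
  · rcases lt_or_gt_of_ne hij with h | h
    · exact coe_ne_coe_of_lt (hmono h) (hspan i j)
    · exact (coe_ne_coe_of_lt (hmono h) (hspan j i)).symm
  · fin_cases i <;> fin_cases j <;> first
      | exact absurd rfl hij
      | exact absurd hw (by decide)
      | exact e₀
      | exact e₁
      | exact e₂
      | exact e₀.symm
      | exact e₁.symm
      | exact e₂.symm

/-- Without the configuration `H`, a non-Seifert splice of an irreducible knot projection makes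
every chord that crosses the spliced one isolated. -/
lemma IsNonSeifertSplice.isReducible {P Q : KnotProjection} (hPQ : IsNonSeifertSplice P Q)
    (hP : ¬ P.IsReducible) (hH : ¬ HasSubChordDiagram P.chordDiagram hWord) :
    Q.IsReducible := by
  obtain ⟨a, s, b, c, t, d, ρ, has, hsb, hbc, hct, htd, hda, hρ, hst, hball, hinj, α, β, -, -,
    hdisj, hint, hQ⟩ := hPQ
  have hcl : ∀ x ∈ Set.Ico a (a + 1), P x ∈ Metric.closedBall (P s) ρ →
      x ∈ Set.Icc a b ∪ Set.Icc c d := fun x hx => (hball x hx).1.1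
  have hcl' : ∀ x ∈ Set.Icc a b ∪ Set.Icc c d, P x ∈ Metric.closedBall (P s) ρ := by
    intro x hx
    refine (hball x ?_).1.2 hx
    rcases hx with hx | hx
    · exact ⟨hx.1, by linarith [hx.2]⟩
    · exact ⟨by linarith [hx.1], by linarith [hx.2]⟩
  obtain ⟨u, hu, v, hv, huv⟩ :=
    P.exists_crossing_chord hP (by linarith : s < t) (by linarith) hst
  have hbad : ∀ x ∈ Set.Icc a b ∪ Set.Icc c d, ∀ y ∈ Set.Ico a (a + 1), P x = P y →
      x = y ∨ (x = s ∧ y = t) ∨ (x = t ∧ y = s) := fun x hx y hy e =>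
    hinj x hx y (hcl y hy (e ▸ hcl' x hx)) e
  have hua : u ∈ Set.Ico a (a + 1) := ⟨by linarith [hu.1], by linarith [hu.2]⟩
  -- Moves `v` into the period starting at `a`. The shifted value `v - 1` would lie in `[a, s)`,
  -- hence in the disc, and is ruled out below.
  obtain ⟨w, hw, hwv, hwu⟩ : ∃ w ∈ Set.Ico a (a + 1), P w = P v ∧ (w < s ∨ t < w) ∧
      (w = v ∨ w = v - 1) := by
    rcases lt_or_ge v (a + 1) with h | h
    · exact ⟨v, ⟨by linarith [hv.1], h⟩, rfl, Or.inr hv.1, Or.inl rfl⟩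
    · refine ⟨v - 1, ⟨by linarith, by linarith [hv.2]⟩, ?_, Or.inl (by linarith [hv.2]),
        Or.inr rfl⟩
      rw [← P.apply_add_one, sub_add_cancel]
  have hne : u ≠ w ∧ ¬ (u = s ∧ w = t) ∧ ¬ (u = t ∧ w = s) := by
    obtain ⟨h1, h2⟩ := hu
    rcases hwu.1 with h | h
    · exact ⟨by linarith, by rintro ⟨rfl, -⟩; linarith, by rintro ⟨rfl, -⟩; linarith⟩
    · exact ⟨by linarith, by rintro ⟨rfl, -⟩; linarith, by rintro ⟨rfl, -⟩; linarith⟩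
  have hu' : u ∉ Set.Icc a b ∪ Set.Icc c d := by
    intro h
    have := hbad u h w hw (huv.trans hwv.symm)
    tauto
  have hw' : w ∉ Set.Icc a b ∪ Set.Icc c d := by
    intro h
    rcases hbad w h u hua (hwv.trans huv.symm) with h1 | h1 | h1
    · exact hne.1 h1.symm
    · exact hne.2.2 ⟨h1.2, h1.1⟩
    · exact hne.2.1 ⟨h1.2, h1.1⟩
  have hub : b < u := by
    by_contra! h
    exact hu' (Or.inl ⟨hua.1, h⟩)
  have huc : u < c := by
    by_contra! h
    exact hu' (Or.inr ⟨h, by linarith [hu.2]⟩)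
  have hwd : d < w := by
    by_contra! h
    rcases hwu.1 with h1 | h1
    · exact hw' (Or.inl ⟨hw.1, by linarith⟩)
    · exact hw' (Or.inr ⟨by linarith, h⟩)
  obtain rfl : w = v := by
    rcases hwu.2 with h | h
    · exact h
    · linarith [hv.2]
  clear hwu hwv hne hw'
  obtain ⟨hwa, hwa'⟩ := hw
  have hpball : P u ∉ Metric.closedBall (P s) ρ := fun h => hu' (hcl u hua h)
  have hends : ∀ {x y : ℝ} (γ : Path (P x) (P y)), x ∈ Set.Icc a b ∪ Set.Icc c d →
      y ∈ Set.Icc a b ∪ Set.Icc c d →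
      (∀ τ ∈ Set.Ioo (0 : unitInterval) 1, γ τ ∈ Metric.ball (P s) ρ) →
      ∀ q ∈ Set.range γ, q ∈ Metric.closedBall (P s) ρ := by
    rintro x y γ hx hy hγ _ ⟨τ, rfl⟩
    rcases eq_or_lt_of_le (unitInterval.nonneg' (t := τ)) with h | h
    · rw [← h, γ.source]; exact hcl' x hx
    rcases eq_or_lt_of_le (unitInterval.le_one' (t := τ)) with h' | h'
    · rw [h', γ.target]; exact hcl' y hy
    exact Metric.ball_subset_closedBall (hγ τ ⟨h, h'⟩)
  have ha : a ∈ Set.Icc a b ∪ Set.Icc c d := Or.inl ⟨le_rfl, by linarith⟩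
  have hb : b ∈ Set.Icc a b ∪ Set.Icc c d := Or.inl ⟨by linarith, le_rfl⟩
  have hc : c ∈ Set.Icc a b ∪ Set.Icc c d := Or.inr ⟨le_rfl, by linarith⟩
  have hd : d ∈ Set.Icc a b ∪ Set.Icc c d := Or.inr ⟨by linarith, le_rfl⟩
  have hα := hends α ha hc fun τ hτ => (hint τ hτ).1
  have hβ := hends β hb hd fun τ hτ => (hint τ hτ).2
  -- Each of the four outer arcs touches the disc only at its end there, which is an end point of
  -- `β` or `α`.
  have hx₁ : ∀ x ∈ Set.Icc b u, P x ∈ Metric.closedBall (P s) ρ → P x ∈ Set.range β := by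
    intro x hx h
    rcases hcl x ⟨by linarith [hx.1], by linarith [hx.2]⟩ h with h | h
    · obtain rfl := le_antisymm h.2 hx.1
      exact ⟨0, β.source⟩
    · linarith [hx.2, h.1]
  have hx₂ : ∀ x ∈ Set.Icc d w, P x ∈ Metric.closedBall (P s) ρ → P x ∈ Set.range β := by
    intro x hx h
    rcases hcl x ⟨by linarith [hx.1], by linarith [hx.2]⟩ h with h | h
    · linarith [hx.1, h.2]
    · obtain rfl := le_antisymm h.2 hx.1
      exact ⟨1, β.target⟩
  have hy₁ : ∀ y ∈ Set.Icc u c, P y ∈ Metric.closedBall (P s) ρ → P y ∈ Set.range α := by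
    intro y hy h
    rcases hcl y ⟨by linarith [hy.1], by linarith [hy.2]⟩ h with h | h
    · linarith [hy.1, h.2]
    · obtain rfl := le_antisymm hy.2 h.1
      exact ⟨1, α.target⟩
  have hy₂ : ∀ y ∈ Set.Icc w (a + 1), P y ∈ Metric.closedBall (P s) ρ → P y ∈ Set.range α := by
    intro y hy h
    rcases eq_or_lt_of_le hy.2 with rfl | h'
    · exact ⟨0, α.source.trans (P.apply_add_one a).symm⟩
    rcases hcl y ⟨by linarith [hy.1], h'⟩ h with h | h
    · linarith [hy.1, h.2]
    · linarith [hy.1, h.2]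
  have hcpt : ∀ x y : ℝ, IsCompact ((fun r : ℝ => P (r : UnitAddCircle)) '' Set.Icc x y) :=
    fun x y => isCompact_Icc.image P.continuous_real
  refine ⟨P u, Q.isNugatory_of_not_isPreconnected ?_ fun hpre => ?_⟩
  · rw [hQ]
    exact Or.inl ⟨⟨_, rfl⟩, hpball⟩
  -- The closed sets are the two pieces of the spliced curve at `P u`: `β` with the arcs from `b` to
  -- `u` and `d` to `w`, and `α` with the other two.
  obtain ⟨q, ⟨-, hqp⟩, hX, hY⟩ := isPreconnected_closed_iff.1 hpre
    (((fun r : ℝ => P (r : UnitAddCircle)) '' Set.Icc b u ∪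
      (fun r : ℝ => P (r : UnitAddCircle)) '' Set.Icc d w) ∪ Set.range β)
    (((fun r : ℝ => P (r : UnitAddCircle)) '' Set.Icc u c ∪
      (fun r : ℝ => P (r : UnitAddCircle)) '' Set.Icc w (a + 1)) ∪ Set.range α)
    (((hcpt _ _).union (hcpt _ _)).union (isCompact_range β.continuous)).isClosed
    (((hcpt _ _).union (hcpt _ _)).union (isCompact_range α.continuous)).isClosed
    (by
      rw [hQ]
      rintro q ⟨⟨⟨z, rfl⟩, hz⟩ | hq | hq, -⟩
      · obtain ⟨x, hx, rfl⟩ := exists_mem_Ico_coe_eq a z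
        have hx' : x ∉ Set.Icc a b ∪ Set.Icc c d := fun h => hz (hcl' x h)
        rcases le_total x u with h1 | h1
        · refine Or.inl (Or.inl (Or.inl ⟨x, ⟨?_, h1⟩, rfl⟩))
          by_contra! h
          exact hx' (Or.inl ⟨hx.1, h.le⟩)
        rcases le_total x c with h2 | h2
        · exact Or.inr (Or.inl (Or.inl ⟨x, ⟨h1, h2⟩, rfl⟩))
        rcases le_total x w with h3 | h3
        · refine Or.inl (Or.inl (Or.inr ⟨x, ⟨?_, h3⟩, rfl⟩))
          by_contra! h
          exact hx' (Or.inr ⟨h2, h.le⟩)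
        · exact Or.inr (Or.inl (Or.inr ⟨x, ⟨h3, hx.2.le⟩, rfl⟩))
      · exact Or.inr (Or.inr hq)
      · exact Or.inl (Or.inr hq))
    (by
      refine ⟨P b, ⟨?_, fun e => hpball (e ▸ hcl' b hb)⟩, Or.inr ⟨0, β.source⟩⟩
      rw [hQ]
      exact Or.inr (Or.inr ⟨0, β.source⟩))
    (by
      refine ⟨P c, ⟨?_, fun e => hpball (e ▸ hcl' c hc)⟩, Or.inr ⟨1, α.target⟩⟩
      rw [hQ]
      exact Or.inr (Or.inl ⟨1, α.target⟩))
  have hαβ : ∀ q ∈ Set.range α, q ∉ Set.range β := fun q h h' =>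
    Set.disjoint_left.1 hdisj h h'
  have hlt : ∀ x y z : ℝ, z ∈ Set.Icc x y → P z ≠ P x → P z ≠ P y → x < z ∧ z < y := by
    intro x y z hz h1 h2
    exact ⟨lt_of_le_of_ne hz.1 (by rintro rfl; exact h1 rfl),
      lt_of_le_of_ne hz.2 (by rintro rfl; exact h2 rfl)⟩
  have hqu : ∀ x : ℝ, P x = q → x ≠ u ∧ x ≠ w := by
    rintro x rfl
    exact ⟨by rintro rfl; exact hqp rfl, by rintro rfl; exact hqp huv.symm⟩
  have hs1 : P ((s + 1 : ℝ) : UnitAddCircle) = P ((t + 1 : ℝ) : UnitAddCircle) := by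
    rw [P.apply_add_one, P.apply_add_one, hst]
  -- If `x` and `y` lie on the same side of `st`, then `uw` is the chord crossing the other two; if
  -- on opposite sides, `st` is. Cases involving `α` or `β` contradict their disjointness.
  rcases hX with (⟨x, hx, hxq⟩ | ⟨x, hx, hxq⟩) | hX <;>
    rcases hY with (⟨y, hy, hyq⟩ | ⟨y, hy, hyq⟩) | hY
  · have hxu := lt_of_le_of_ne hx.2 (hqu x hxq).1
    have hyu := lt_of_le_of_ne hy.1 (hqu y hyq).1.symm
    exact hH (P.hasSubChordDiagram_hWord (x₀ := u) (x₁ := y) (x₂ := t) (x₃ := w) (x₄ := s + 1)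
      (x₅ := x + 1) hyu (by linarith [hy.2]) (by linarith) (by linarith) (by linarith [hx.1])
      (by linarith) huv (by rw [P.apply_add_one]; exact hyq.trans hxq.symm)
      (by rw [P.apply_add_one, hst]))
  · have hxu := lt_of_le_of_ne hx.2 (hqu x hxq).1
    have hyw := lt_of_le_of_ne hy.1 (hqu y hyq).2.symm
    exact hH (P.hasSubChordDiagram_hWord (x₀ := s) (x₁ := x) (x₂ := u) (x₃ := t) (x₄ := w)
      (x₅ := y) (by linarith [hx.1]) hxu (by linarith) (by linarith) hyw
      (by linarith [hy.2]) hst (hxq.trans hyq.symm) huv)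
  · subst hxq
    exact hαβ _ hY (hx₁ x hx (hα _ hY))
  · have hxw := lt_of_le_of_ne hx.2 (hqu x hxq).2
    have hyu := lt_of_le_of_ne hy.1 (hqu y hyq).1.symm
    exact hH (P.hasSubChordDiagram_hWord (x₀ := s) (x₁ := u) (x₂ := y) (x₃ := t) (x₄ := x)
      (x₅ := w) (by linarith) hyu (by linarith [hy.2]) (by linarith [hx.1]) hxw
      (by linarith) hst huv (hyq.trans hxq.symm))
  · have hxw := lt_of_le_of_ne hx.2 (hqu x hxq).2
    have hyw := lt_of_le_of_ne hy.1 (hqu y hyq).2.symm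
    exact hH (P.hasSubChordDiagram_hWord (x₀ := w) (x₁ := y) (x₂ := s + 1) (x₃ := u + 1)
      (x₄ := t + 1) (x₅ := x + 1) hyw (by linarith [hy.2]) (by linarith) (by linarith)
      (by linarith [hx.1]) (by linarith) (by rw [P.apply_add_one, huv])
      (by rw [P.apply_add_one]; exact hyq.trans hxq.symm) hs1)
  · subst hxq
    exact hαβ _ hY (hx₂ x hx (hα _ hY))
  · subst hyq
    exact hαβ _ (hy₁ y hy (hβ _ hX)) hX
  · subst hyq
    exact hαβ _ (hy₂ y hy (hβ _ hX)) hX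
  · exact hαβ q hY hX

lemma reductivity_le {P : KnotProjection} {n : ℕ} (h : P.ReducesIn n) : P.reductivity ≤ n :=
  sInf_le ⟨n, h, rfl⟩

/-- A finite value excludes the empty set, whose infimum is `⊤`, and a nonempty set of this kind
attains its infimum. -/
lemma reducesIn_of_reductivity_eq {P : KnotProjection} {n : ℕ} (h : P.reductivity = n) :
    P.ReducesIn n := by
  have hne : ((fun n : ℕ => (n : ℕ∞)) '' {n : ℕ | P.ReducesIn n}).Nonempty := by
    by_contra hc
    rw [reductivity, Set.not_nonempty_iff_eq_empty.1 hc, sInf_empty] at h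
    exact ENat.natCast_ne_top n h.symm
  obtain ⟨m, hm, hmn⟩ := csInf_mem hne
  have : (m : ℕ∞) = n := hmn.trans h
  rwa [← Nat.cast_inj.1 this]

end KnotProjection

theorem mainTheorem10 (P : KnotProjection) (hP : P.reductivity = 2) :
    HasSubChordDiagram P.chordDiagram hWord := by
  by_contra hH
  have hirr : ¬ P.IsReducible := by
    intro h
    have := KnotProjection.reductivity_le (KnotProjection.ReducesIn.zero h)
    rw [hP] at this
    exact absurd this (by decide)
  have h2 : P.ReducesIn 2 := KnotProjection.reducesIn_of_reductivity_eq hP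
  -- Only the first of the two splices matters: it already gives a reducible projection.
  cases h2 with
  | succ hPQ _ =>
    have := KnotProjection.reductivity_le (KnotProjection.ReducesIn.succ hPQ (KnotProjection.ReducesIn.zero (hPQ.isReducible hirr hH)))
    rw [hP] at this
    exact absurd this (by decide)
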